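/- For natural numbers $a, d_1, \ldots, d_k$ let \[ H(a; d_1, \ldots, d_k) = \Bigl\{ a + \sum_{i \in I} d_i \;:\; I \subseteq \{1, \ldots, k\} \Bigr\} \] be the Hilbert cube of dimension $k$. For all natural numbers $r$ and $k$ there is a number $n = n(r,k)$ such that for every $r$-coloring of the edges of the complete graph on the vertex set $[n] = \{1, \ldots, n\}$ there is a Hilbert cube $H = H(a; d_1, \ldots, d_k) \subseteq [n]$ whose $2^k$ elements $a + \sum_{i \in I} d_i$ are pairwise distinct and such that all edges joining two elements of $H$ have the same color. -/

import Mathlib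

/-- The Hilbert cube `H(a; d_1, …, d_k) = {a + ∑_{i ∈ I} d_i : I ⊆ [k]}`. -/
def hilbertCube (a : ℕ) {k : ℕ} (d : Fin k → ℕ) : Set ℕ :=
  {x | ∃ I : Finset (Fin k), x = a + ∑ i ∈ I, d i}

/-- All edges of the complete graph on `[n]` both of whose endpoints lie in `H` receive
the same color under `χ`. -/
def IsMonochromaticOn {n r : ℕ} (χ : SimpleGraph.TopEdgeLabeling (Set.Icc 1 n) (Fin r))
    (H : Set ℕ) : Prop :=
  ∃ c : Fin r, ∀ (x y : Set.Icc 1 n) (hxy : x ≠ y),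
    (x : ℕ) ∈ H → (y : ℕ) ∈ H → χ.get x y hxy = c

/-! The cube is built by doubling. Hales–Jewett over the alphabet `Fin q → Fin L` yields `q`
homothetic copies of `[0, L)`, in consecutive blocks and with a common ratio, such that each pair of
copies has a single color between them. For large `q`, two copies are also colored alike inside.
Placing the same smaller cube in both adds one dimension, and the color of a pair depends only on
the top index where its elements differ. With `|K| * k` indices, some `k` of them share a color and
span the required cube. -/

/-- Along a combinatorial line of `ι → β → Fin L`, each coordinate
sum moves along an arithmetic progression with common difference the number of active
coordinates of the line. -/
lemma Combinatorics.Line.exists_sum_eq {ι β : Type*} [Fintype ι] {L : ℕ}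
    (l : Combinatorics.Line (β → Fin L) ι) :
    ∃ (e : ℕ) (T : β → ℕ), 0 < e ∧
      ∀ x j, ∑ i, (l x i j : ℕ) = T j + e * (x j : ℕ) := by
  classical
  refine ⟨(Finset.univ.filter fun i => l.idxFun i = none).card,
    fun j => ∑ i, ((l.idxFun i).elim 0 fun f => (f j : ℕ)), ?_, fun x j => ?_⟩
  · obtain ⟨i, hi⟩ := l.proper
    exact Finset.card_pos.mpr ⟨i, by simpa using hi⟩
  · rw [Finset.card_filter, Finset.sum_mul, ← Finset.sum_add_distrib]
    refine Finset.sum_congr rfl fun i _ => ?_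
    cases h : l.idxFun i <;> simp [h]

/-- In every finite coloring of the pairs of a long interval there are two homothetic copies
`t + e • [0, L)` and `s + e • [0, L)` of `[0, L)`, the first to the left of the second, which are
colored in the same way and such that all pairs between them have the same color. -/
lemma exists_homogeneous_homothetic_pair (K : Type*) [Finite K] (L : ℕ) :
    ∃ N : ℕ, ∀ C : ℕ → ℕ → K, ∃ (t s e : ℕ) (c : K), 0 < e ∧
      (∀ x < L, ∀ y < L, t + e * x < s + e * y ∧ s + e * y < N ∧
        C (t + e * x) (s + e * y) = c) ∧
      ∀ x < L, ∀ y < L, C (t + e * x) (t + e * y) = C (s + e * x) (s + e * y) := by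
  classical
  have := Fintype.ofFinite K
  -- One more than the number of colorings inside a copy, so that two of the `q` copies agree.
  set q := Fintype.card (Fin L → Fin L → K) + 1 with hq
  obtain ⟨ι, _, hι⟩ := Combinatorics.Line.exists_mono_in_high_dimension
    (Fin q → Fin L) (Fin q → Fin q → K)
  set n := Fintype.card ι * L + 1 with hn
  refine ⟨q * n, fun C => ?_⟩
  -- A word encodes one point per block of length `n`; its color is the whole matrix of pair colors.
  obtain ⟨l, c, hl⟩ := hι fun v j j' =>
    C (j * n + ∑ i, (v i j : ℕ)) (j' * n + ∑ i, (v i j' : ℕ))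
  obtain ⟨e, T, he, hT⟩ := l.exists_sum_eq
  have hlt : ∀ (x : Fin q → Fin L) (j : Fin q), T j + e * (x j : ℕ) < n := fun x j => by
    rw [← hT, hn, Nat.lt_succ_iff]
    calc ∑ i, (l x i j : ℕ) ≤ ∑ _i : ι, L := Finset.sum_le_sum fun i _ => (l x i j).2.le
      _ = _ := by simp
  obtain ⟨j, j', hne, hjj'⟩ := Fintype.exists_ne_map_eq_of_card_lt
    (fun (j : Fin q) (x y : Fin L) => C (j * n + T j + e * x) (j * n + T j + e * y))
    (by rw [Fintype.card_fin, hq]; exact Nat.lt_succ_self _)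
  wlog hlt' : j < j' generalizing j j'
  · exact this j' j hne.symm hjj'.symm (lt_of_le_of_ne (not_lt.mp hlt') hne.symm)
  refine ⟨j * n + T j, j' * n + T j', e, c j j', he, fun x hx y hy => ?_, fun x hx y hy =>
    congr_fun (congr_fun hjj' ⟨x, hx⟩) ⟨y, hy⟩⟩
  -- Components `j` and `j'` of a letter vary independently, so one line covers every pair `x`, `y`.
  set v : Fin q → Fin L := Function.update (fun _ => ⟨x, hx⟩) j' ⟨y, hy⟩ with hv
  have hvj : (v j : ℕ) = x := by simp [hv, Function.update_of_ne hne]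
  have hvj' : (v j' : ℕ) = y := by simp [hv]
  have h1 := hlt v j
  have h2 := hlt v j'
  have h3 := congr_fun (congr_fun (hl v) j) j'
  simp only [hT] at h3
  rw [hvj] at h1 h3
  rw [hvj'] at h2 h3
  have h4 : ((j : ℕ) + 1) * n ≤ j' * n := Nat.mul_le_mul_right n hlt'
  have h5 : ((j' : ℕ) + 1) * n ≤ q * n := Nat.mul_le_mul_right n j'.2
  rw [Nat.add_one_mul] at h4 h5
  exact ⟨by omega, by omega, by rw [← h3, add_assoc, add_assoc]⟩

/-- In every finite coloring of the pairs of a long interval there is a Hilbert cube of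
dimension `m` in which the color of a pair depends only on the largest index at which the two
elements differ. -/
lemma exists_hilbertCube_color_eq_of_top_index (K : Type*) [Finite K] (m : ℕ) :
    ∃ N : ℕ, ∀ C : ℕ → ℕ → K, ∃ (a : ℕ) (d : ℕ → ℕ) (c : ℕ → K),
      (∀ I ⊆ Finset.range m, a + ∑ i ∈ I, d i < N) ∧
      ∀ I ⊆ Finset.range m, ∀ J ⊆ Finset.range m, ∀ i, i ∉ I → i ∈ J →
        (∀ j, i < j → (j ∈ I ↔ j ∈ J)) →
        ∑ i ∈ I, d i < ∑ i ∈ J, d i ∧ C (a + ∑ i ∈ I, d i) (a + ∑ i ∈ J, d i) = c i := by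
  induction m with
  | zero =>
    refine ⟨1, fun C => ⟨0, 0, fun _ => C 0 0, by simp, fun I _ J hJ i _ hi => ?_⟩⟩
    simpa using hJ hi
  | succ m ih =>
    obtain ⟨L, hL⟩ := ih
    obtain ⟨N, hN⟩ := exists_homogeneous_homothetic_pair K L
    refine ⟨N, fun C => ?_⟩
    obtain ⟨t, s, e, c₀, he, hbi, hcopy⟩ := hN C
    obtain ⟨a, d, c, hlt, hcol⟩ := hL fun x y => C (t + e * x) (t + e * y)
    have hts : t < s := by
      have ha : a < L := by simpa using hlt ∅ (by simp)
      have := (hbi a ha a ha).1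
      omega
    -- The new top difference translates the copy at `t` onto the copy at `s`.
    set d' : ℕ → ℕ := fun j => if j = m then s - t else e * d j
    have herase : ∀ I ⊆ Finset.range (m + 1), I.erase m ⊆ Finset.range m := fun I hI j hj => by
      have h1 := Finset.ne_of_mem_erase hj
      have h2 := Finset.mem_range.mp (hI (Finset.mem_of_mem_erase hj))
      exact Finset.mem_range.mpr (by omega)
    have hsum_erase : ∀ I : Finset ℕ, ∑ i ∈ I.erase m, d' i = e * ∑ i ∈ I.erase m, d i :=
      fun I => by
        rw [Finset.mul_sum]
        exact Finset.sum_congr rfl fun i hi => if_neg (Finset.ne_of_mem_erase hi)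
    have hnotMem : ∀ I : Finset ℕ, m ∉ I →
        t + e * a + ∑ i ∈ I, d' i = t + e * (a + ∑ i ∈ I.erase m, d i) := fun I hI => by
      have := hsum_erase I
      rw [Finset.erase_eq_of_notMem hI] at this ⊢
      rw [this]; ring
    have hmem : ∀ I : Finset ℕ, m ∈ I →
        t + e * a + ∑ i ∈ I, d' i = s + e * (a + ∑ i ∈ I.erase m, d i) := fun I hI => by
      have h1 : d' m = s - t := if_pos rfl
      rw [← Finset.add_sum_erase I d' hI, hsum_erase, h1, mul_add]
      omega
    refine ⟨t + e * a, d', fun i => if i = m then c₀ else c i, fun I hI => ?_,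
      fun I hI J hJ i hiI hiJ hij => ?_⟩
    · have h1 := hbi _ (hlt _ (herase I hI)) _ (hlt _ (herase I hI))
      by_cases hm : m ∈ I
      · rw [hmem I hm]; exact h1.2.1
      · rw [hnotMem I hm]; exact h1.1.trans h1.2.1
    · rw [← Nat.add_lt_add_iff_left (k := t + e * a)]
      have hI' := hlt _ (herase I hI)
      have hJ' := hlt _ (herase J hJ)
      rcases eq_or_ne i m with rfl | him
      · rw [hnotMem I hiI, hmem J hiJ]
        simp only [if_true]
        exact ⟨(hbi _ hI' _ hJ').1, (hbi _ hI' _ hJ').2.2⟩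
      · have him' : i < m := by
          have := Finset.mem_range.mp (hJ hiJ)
          omega
        obtain ⟨h1, h2⟩ := hcol _ (herase I hI) _ (herase J hJ) i
          (fun h => hiI (Finset.mem_of_mem_erase h)) (Finset.mem_erase.mpr ⟨him, hiJ⟩)
          (fun j hj => by simp [Finset.mem_erase, hij j hj])
        have h3 := Nat.mul_lt_mul_of_pos_left (Nat.add_lt_add_left h1 a) he
        simp only [if_neg him]
        by_cases hm : m ∈ J
        · rw [hmem J hm, hmem I ((hij m him').mpr hm), ← hcopy _ hI' _ hJ']
          exact ⟨Nat.add_lt_add_left h3 s, h2⟩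
        · rw [hnotMem J hm, hnotMem I (fun h => hm ((hij m him').mp h))]
          exact ⟨Nat.add_lt_add_left h3 t, h2⟩

/-- The largest index at which two distinct finite sets differ. -/
lemma Finset.exists_max_mem_ne {α : Type*} [LinearOrder α] {I J : Finset α} (h : I ≠ J) :
    ∃ i, ((i ∉ I ∧ i ∈ J) ∨ (i ∉ J ∧ i ∈ I)) ∧ ∀ j, i < j → (j ∈ I ↔ j ∈ J) := by
  have hne : (symmDiff I J).Nonempty :=
    Finset.nonempty_iff_ne_empty.mpr fun h' => h (symmDiff_eq_bot.mp h')
  refine ⟨(symmDiff I J).max' hne, ?_, fun j hj => ?_⟩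
  · have := Finset.mem_symmDiff.mp (Finset.max'_mem _ hne)
    tauto
  · have : j ∉ symmDiff I J := fun hj' => absurd (Finset.le_max' _ _ hj') (not_le.mpr hj)
    rw [Finset.mem_symmDiff] at this
    tauto

/-- In every finite coloring of the pairs `x < y` of a long interval there is a nondegenerate
monochromatic Hilbert cube of dimension `k`. -/
lemma exists_mono_hilbertCube (K : Type*) [Finite K] (k : ℕ) :
    ∃ N : ℕ, ∀ C : ℕ → ℕ → K, ∃ (a : ℕ) (d : Fin k → ℕ) (c : K),
      (∀ I : Finset (Fin k), a + ∑ i ∈ I, d i < N) ∧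
      (Function.Injective fun I : Finset (Fin k) => a + ∑ i ∈ I, d i) ∧
      ∀ x ∈ hilbertCube a d, ∀ y ∈ hilbertCube a d, x < y → C x y = c := by
  classical
  have := Fintype.ofFinite K
  obtain ⟨N, hN⟩ := exists_hilbertCube_color_eq_of_top_index K (Fintype.card K * k)
  refine ⟨N, fun C => ?_⟩
  obtain ⟨a, d, c, hlt, hcol⟩ := hN C
  obtain ⟨c₀, -, hc₀⟩ := Finset.exists_le_card_fiber_of_mul_le_card_of_maps_to
    (s := Finset.range (Fintype.card K * k)) (t := Finset.univ) (f := c) (n := k)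
    (fun _ _ => Finset.mem_univ _) ⟨C 0 0, Finset.mem_univ _⟩ (by simp)
  obtain ⟨S, hS, hcard⟩ := Finset.exists_subset_card_eq hc₀
  have hSmem : ∀ i ∈ S, i ∈ Finset.range (Fintype.card K * k) ∧ c i = c₀ :=
    fun i hi => Finset.mem_filter.mp (hS hi)
  set f := (S.orderEmbOfFin hcard).toEmbedding
  have hf : ∀ I : Finset (Fin k), I.map f ⊆ S := fun I j hj => by
    obtain ⟨i, -, rfl⟩ := Finset.mem_map.mp hj
    exact Finset.orderEmbOfFin_mem S hcard i
  have hrange : ∀ I : Finset (Fin k), I.map f ⊆ Finset.range (Fintype.card K * k) :=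
    fun I j hj => (hSmem j (hf I hj)).1
  have hsum : ∀ I : Finset (Fin k), ∑ i ∈ I, d (f i) = ∑ i ∈ I.map f, d i :=
    fun I => (Finset.sum_map I f d).symm
  have key : ∀ I J : Finset (Fin k), I ≠ J →
      (∑ i ∈ I, d (f i) < ∑ i ∈ J, d (f i) ∧
        C (a + ∑ i ∈ I, d (f i)) (a + ∑ i ∈ J, d (f i)) = c₀) ∨
      ∑ i ∈ J, d (f i) < ∑ i ∈ I, d (f i) := fun I J hIJ => by
    obtain ⟨i, hi, hj⟩ := Finset.exists_max_mem_ne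
      (fun h => hIJ (Finset.map_injective f h))
    rw [hsum, hsum]
    rcases hi with ⟨h1, h2⟩ | ⟨h1, h2⟩
    · rw [← (hSmem i (hf J h2)).2]
      exact .inl (hcol _ (hrange I) _ (hrange J) i h1 h2 hj)
    · exact .inr (hcol _ (hrange J) _ (hrange I) i h1 h2 fun j hij => (hj j hij).symm).1
  refine ⟨a, fun i => d (f i), c₀, fun I => ?_, fun I J hIJ => ?_, ?_⟩
  · rw [hsum]; exact hlt _ (hrange I)
  · by_contra hne
    have := key I J hne
    simp only at hIJ
    omega
  · rintro _ ⟨I, rfl⟩ _ ⟨J, rfl⟩ hxy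
    have hne : I ≠ J := by rintro rfl; exact lt_irrefl _ hxy
    rcases key I J hne with h | h
    · exact h.2
    · exact absurd h (by simpa using hxy.le)

theorem theorem3p1 (r k : ℕ) :
    ∃ n : ℕ, ∀ χ : SimpleGraph.TopEdgeLabeling (Set.Icc 1 n) (Fin r),
      ∃ (a : ℕ) (d : Fin k → ℕ),
        hilbertCube a d ⊆ Set.Icc 1 n ∧
        (hilbertCube a d).ncard = 2 ^ k ∧
        IsMonochromaticOn χ (hilbertCube a d) := by
  classical
  rcases Nat.eq_zero_or_pos r with rfl | hr
  -- Two vertices give an edge, which cannot be colored from `Fin 0`.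
  · exact ⟨2, fun χ => (χ.get ⟨1, by simp⟩ ⟨2, by simp⟩ (by simp)).elim0⟩
  obtain ⟨N, hN⟩ := exists_mono_hilbertCube (Fin r) k
  refine ⟨N, fun χ => ?_⟩
  -- Shifting by one moves `[0, N)` to `[1, N]`; the default color is never used on the cube.
  obtain ⟨a, d, c, hlt, hinj, hmono⟩ := hN fun x y =>
    if h : (x + 1 ∈ Set.Icc 1 N ∧ y + 1 ∈ Set.Icc 1 N) ∧ x ≠ y then
      χ.get ⟨x + 1, h.1.1⟩ ⟨y + 1, h.1.2⟩ (by simpa using h.2) else ⟨0, hr⟩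
  have hshift : ∀ x ∈ hilbertCube (a + 1) d, ∃ z ∈ hilbertCube a d, x = z + 1 := by
    rintro _ ⟨I, rfl⟩
    exact ⟨_, ⟨I, rfl⟩, by ring⟩
  have hlt_get : ∀ (x y : Set.Icc 1 N) (hxy : x ≠ y), (x : ℕ) ∈ hilbertCube (a + 1) d →
      (y : ℕ) ∈ hilbertCube (a + 1) d → x < y → χ.get x y hxy = c := by
    rintro ⟨x, hx'⟩ ⟨y, hy'⟩ hxy hx hy h
    obtain ⟨u, hu, rfl⟩ := hshift _ hx
    obtain ⟨v, hv, rfl⟩ := hshift _ hy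
    have h' : u < v := by simpa using h
    have := hmono u hu v hv h'
    rwa [dif_pos ⟨⟨hx', hy'⟩, h'.ne⟩] at this
  refine ⟨a + 1, d, ?_, ?_, c, fun x y hxy hx hy => ?_⟩
  · rintro _ ⟨I, rfl⟩
    have := hlt I
    exact ⟨by omega, by omega⟩
  · have : hilbertCube (a + 1) d =
        Set.range fun I : Finset (Fin k) => a + 1 + ∑ i ∈ I, d i :=
      Set.ext fun x => exists_congr fun I => eq_comm
    rw [this, Set.ncard_def, ← Set.image_univ, Set.InjOn.encard_image, ← Set.ncard_def,
      Set.ncard_univ]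
    · simp
    · intro I _ J _ hIJ
      exact hinj (by simp only at hIJ ⊢; omega)
  · rcases lt_or_gt_of_ne hxy with h | h
    · exact hlt_get x y hxy hx hy h
    · rw [SimpleGraph.EdgeLabeling.get_comm]
      exact hlt_get y x hxy.symm hy hx h
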